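/- Let $C$ be a smooth projective connected complex curve (a compact connected Riemann surface) of genus $g$, let $\eta_1,\dots,\eta_g$ be a basis of $H^0(C,\Omega^1_C)$, and let $\alpha_1,\dots,\alpha_g,\beta_1,\dots,\beta_g$ be a symplectic basis of $H_1(C,\mathbb Z)$, that is, a $\mathbb Z$-basis in which the intersection pairing has matrix $$E=\begin{pmatrix}0&I\\-I&0\end{pmatrix}\in M_{2g,2g}(\mathbb Z).$$ Let $\Omega=\bigl(\int_{\alpha_j}\eta_i\,\big|\,\int_{\beta_j}\eta_i\bigr)_{i,j}\in M_{g,2g}(\mathbb C)$ be the period matrix, $\Lambda=\Omega\mathbb Z^{2g}$ the period lattice, and $J=\mathbb C^g/\Lambda$ the Jacobian of $C$. Let $H$ be the natural polarization of $J$: the positive definite hermitian form on $\mathbb C^g$ (linear in the first variable) whose imaginary part, on $\Lambda\cong H_1(C,\mathbb Z)$, is minus the intersection pairing. It is principal, i.e. the homomorphism $\lambda\colon J\to J^\vee$ to the dual torus, $v\mapsto H(v,\cdot)$, is an isomorphism. For an endomorphism $\phi$ of $J$ let $\phi^\vee\colon J^\vee\to J^\vee$ be the dual endomorphism, and let $\phi^\dagger=\lambda^{-1}\circ\phi^\vee\circ\lambda\in\operatorname{End}(J)$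 be its image under the Rosati involution. A pair $(T,R)$ with $T\in M_{g,g}(\mathbb C)$ and $R\in M_{2g,2g}(\mathbb Z)$ corresponds to $\phi$ (as tangent and homology representation) if $\phi$ is induced by $T\colon\mathbb C^g\to\mathbb C^g$ and $T\Omega=\Omega R$. Let $\phi\colon J\to J$ be an endomorphism with corresponding pair $(T,R)$. Then $\phi^\dagger$ corresponds to a pair $(T^\dagger,R^\dagger)$ with $$R^\dagger=-E\,R^t\,E ,$$ and $R^\dagger$ is the only homology representation of $\phi^\dagger$. Moreover $R^\dagger$ is the adjoint of $R$ with respect to $E$: $(R^\dagger x)^tEy=x^tE(Ry)$ for all $x,y\in\mathbb Z^{2g}$. -/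

import Mathlib

open scoped Manifold Topology ComplexConjugate Matrix
open CategoryTheory

universe u

noncomputable section

/-! ## Complex tori, their endomorphisms, dual tori, polarizations, the Rosati involution -/

namespace ComplexTorus

section Torus

variable {V : Type*} [NormedAddCommGroup V] [NormedSpace ℂ V]

/-- A map `f : V ⧸ Λ → V ⧸ Λ` is holomorphic if near every point of `V` it has a holomorphic
lift `F` to `V`.  (When `Λ` is a lattice, the projection `V → V ⧸ Λ` is a local biholomorphism,
and this is holomorphy in the usual charts of the complex torus.) -/
def IsHolomorphic (Λ : AddSubgroup V) (f : V ⧸ Λ → V ⧸ Λ) : Prop :=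
  ∀ x : V, ∃ F : V → V, AnalyticAt ℂ F x ∧ ∀ᶠ v in 𝓝 x, (F v : V ⧸ Λ) = f (v : V ⧸ Λ)

/-- An endomorphism of the complex torus `V ⧸ Λ`: a holomorphic homomorphism of groups. -/
structure Endo (Λ : AddSubgroup V) where
  toHom : V ⧸ Λ →+ V ⧸ Λ
  holomorphic : IsHolomorphic Λ toHom

/-- A preconnected subset of a countable subset of a normed group has at most one point. -/
theorem eq_of_isPreconnected_of_countable {V : Type*} [NormedAddCommGroup V] {s t : Set V} (ht : t.Countable) (hst : s ⊆ t)
    (hs : IsPreconnected s) {x y : V} (hx : x ∈ s) (hy : y ∈ s) : x = y :=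
  ht.isTotallyDisconnected s hst hs hx hy

/-- A holomorphic endomorphism of `V ⧸ Λ` is induced by a linear map of `V`.  Only countability
of `Λ` is needed. -/
theorem Endo.exists_lift [FiniteDimensional ℂ V] {Λ : AddSubgroup V} [Countable Λ] (φ : Endo Λ) :
    ∃ F : V →ₗ[ℂ] V, ∀ v : V, ((F v : V) : V ⧸ Λ) = φ.toHom (v : V ⧸ Λ) := by
  have := FiniteDimensional.complete ℂ V
  obtain ⟨F, hF, hFl⟩ := φ.holomorphic 0
  have hc : ∀ᶠ v in 𝓝 (0 : V), ContinuousAt F v := by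
    filter_upwards [hF.eventually_analyticAt] with v hv using hv.continuousAt
  obtain ⟨r, hr, hball⟩ := Metric.eventually_nhds_iff_ball.1 (hFl.and hc)
  have hΛ : (Λ : Set V).Countable := Set.to_countable _
  have hF0 : F 0 ∈ Λ := by
    have := (hball 0 (Metric.mem_ball_self hr)).1
    rw [show ((0 : V) : V ⧸ Λ) = 0 from rfl, map_zero] at this
    exact (QuotientAddGroup.eq_zero_iff _).1 this
  -- homogeneity of `F - F 0` under division by natural numbers, near the origin
  have key : ∀ n : ℕ, 0 < n → ∀ v ∈ Metric.ball (0 : V) r,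
      n • (F ((n : ℝ)⁻¹ • v) - F 0) = F v - F 0 := by
    intro n hn v hv
    have hn1 : (1 : ℝ) ≤ n := by exact_mod_cast hn
    have hsm : ∀ s ∈ Set.Icc (0 : ℝ) 1, s • v ∈ Metric.ball (0 : V) r := by
      intro s hs
      rw [mem_ball_zero_iff] at hv ⊢
      rw [norm_smul, Real.norm_of_nonneg hs.1]
      nlinarith [hs.2, norm_nonneg v]
    have hsn : ∀ s ∈ Set.Icc (0 : ℝ) 1, (n : ℝ)⁻¹ * s ∈ Set.Icc (0 : ℝ) 1 := by
      intro s hs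
      refine ⟨mul_nonneg (by positivity) hs.1, ?_⟩
      exact mul_le_one₀ (inv_le_one_of_one_le₀ hn1) hs.1 hs.2
    let G : ℝ → V := fun s => n • (F (((n : ℝ)⁻¹ * s) • v) - F 0) - (F (s • v) - F 0)
    have hG : ContinuousOn G (Set.Icc 0 1) := by
      intro s hs
      have h1 : ContinuousAt (fun s : ℝ => F (s • v)) s :=
        ContinuousAt.comp (f := fun s : ℝ => s • v) (hball _ (hsm s hs)).2 (by fun_prop)
      have h2 : ContinuousAt (fun s : ℝ => F (((n : ℝ)⁻¹ * s) • v)) s :=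
        ContinuousAt.comp (f := fun s : ℝ => ((n : ℝ)⁻¹ * s) • v)
          (hball _ (hsm _ (hsn s hs))).2 (by fun_prop)
      exact (((h2.sub continuousAt_const).const_smul n).sub
        (h1.sub continuousAt_const)).continuousWithinAt
    have hGΛ : G '' Set.Icc 0 1 ⊆ Λ := by
      rintro _ ⟨s, hs, rfl⟩
      rw [SetLike.mem_coe, ← QuotientAddGroup.eq_zero_iff]
      have e1 := (hball _ (hsm s hs)).1
      have e2 := (hball _ (hsm _ (hsn s hs))).1
      have e0 : ((F 0 : V) : V ⧸ Λ) = 0 := (QuotientAddGroup.eq_zero_iff _).2 hF0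
      have hx : n • (((n : ℝ)⁻¹ * s) • v) = s • v := by
        rw [← Nat.cast_smul_eq_nsmul ℝ, smul_smul, mul_inv_cancel_left₀ (by positivity)]
      simp only [G, QuotientAddGroup.mk_sub, QuotientAddGroup.mk_nsmul, e0, sub_zero, e1, e2]
      rw [← map_nsmul, ← QuotientAddGroup.mk_nsmul, hx, sub_self]
    have h := eq_of_isPreconnected_of_countable hΛ hGΛ (isPreconnected_Icc.image G hG)
      (Set.mem_image_of_mem G (Set.right_mem_Icc.2 zero_le_one))
      (Set.mem_image_of_mem G (Set.left_mem_Icc.2 zero_le_one))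
    simpa [G, sub_eq_zero] using h
  -- hence `F - F 0` equals its derivative near the origin
  let L := fderiv ℂ F 0
  have hL : HasFDerivAt F L 0 := hF.differentiableAt.hasFDerivAt
  have hFL : ∀ v ∈ Metric.ball (0 : V) r, F v - F 0 = L v := by
    intro v hv
    have hlim := (hL.restrictScalars ℝ).lim_real v
    have h2 := hlim.comp tendsto_natCast_atTop_atTop
    have h3 : Filter.Tendsto (fun _ : ℕ => F v - F 0) Filter.atTop (𝓝 (L v)) := by
      refine h2.congr' ?_
      filter_upwards [Filter.eventually_gt_atTop 0] with n hn
      have := key n hn v hv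
      simp only [Function.comp, zero_add]
      rw [Nat.cast_smul_eq_nsmul ℝ, this]
    exact tendsto_nhds_unique tendsto_const_nhds h3
  refine ⟨L.toLinearMap, fun v => ?_⟩
  obtain ⟨n, hn⟩ := exists_nat_gt (‖v‖ / r)
  have hn0 : (0 : ℝ) < n := lt_of_le_of_lt (by positivity) hn
  set w : V := (n : ℝ)⁻¹ • v with hw
  have hwb : w ∈ Metric.ball (0 : V) r := by
    rw [mem_ball_zero_iff, hw, norm_smul, norm_inv, Real.norm_of_nonneg hn0.le,
      inv_mul_lt_iff₀ hn0]
    rwa [div_lt_iff₀ hr] at hn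
  have hv : v = n • w := by
    rw [hw, ← Nat.cast_smul_eq_nsmul ℝ, smul_smul, mul_inv_cancel₀ hn0.ne', one_smul]
  have e0 : ((F 0 : V) : V ⧸ Λ) = 0 := (QuotientAddGroup.eq_zero_iff _).2 hF0
  have e1 : ((L w : V) : V ⧸ Λ) = φ.toHom w := by
    rw [← hFL w hwb, QuotientAddGroup.mk_sub, e0, sub_zero, (hball w hwb).1]
  rw [hv]
  simp only [ContinuousLinearMap.coe_coe, map_nsmul, QuotientAddGroup.mk_nsmul, e1]

/-- The linear lift of an endomorphism (its tangent map) is unique. -/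
theorem lift_unique {Λ : AddSubgroup V} [Countable Λ] {F G : V →ₗ[ℂ] V}
    (h : ∀ v : V, ((F v : V) : V ⧸ Λ) = ((G v : V) : V ⧸ Λ)) : F = G := by
  ext v
  let p : ℝ → V := fun s => s • (F v - G v)
  have hp : p '' Set.Icc 0 1 ⊆ (Λ : Set V) := by
    rintro _ ⟨s, -, rfl⟩
    have h1 := h ((s : ℂ) • v)
    rw [← sub_eq_zero, ← QuotientAddGroup.mk_sub, QuotientAddGroup.eq_zero_iff, map_smul,
      map_smul, ← smul_sub] at h1
    exact h1
  have h2 := eq_of_isPreconnected_of_countable (Set.to_countable (Λ : Set V)) hp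
    (isPreconnected_Icc.image p (by fun_prop))
    (Set.mem_image_of_mem p (Set.right_mem_Icc.2 zero_le_one))
    (Set.mem_image_of_mem p (Set.left_mem_Icc.2 zero_le_one))
  simpa [p, sub_eq_zero] using h2

/-- The tangent map `V → V` of an endomorphism of `V ⧸ Λ`: the unique linear map inducing it. -/
def Endo.tangentMap [FiniteDimensional ℂ V] {Λ : AddSubgroup V} [Countable Λ] (φ : Endo Λ) :
    V →ₗ[ℂ] V :=
  φ.exists_lift.choose

theorem Endo.mk_tangentMap [FiniteDimensional ℂ V] {Λ : AddSubgroup V} [Countable Λ]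
    (φ : Endo Λ) (v : V) :
    ((φ.tangentMap v : V) : V ⧸ Λ) = φ.toHom (v : V ⧸ Λ) :=
  φ.exists_lift.choose_spec v

theorem Endo.tangentMap_mem [FiniteDimensional ℂ V] {Λ : AddSubgroup V} [Countable Λ]
    (φ : Endo Λ) {v : V} (hv : v ∈ Λ) : φ.tangentMap v ∈ Λ := by
  rw [← QuotientAddGroup.eq_zero_iff, φ.mk_tangentMap, (QuotientAddGroup.eq_zero_iff v).2 hv,
    map_zero]

/-- The dual lattice: the conjugate-linear functionals on `V` whose imaginary part is integral
on `Λ`. -/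
def dualLattice (Λ : AddSubgroup V) : AddSubgroup (V →ₗ⋆[ℂ] ℂ) where
  carrier := {l | ∀ v ∈ Λ, ∃ n : ℤ, (l v).im = n}
  zero_mem' := fun _ _ => ⟨0, by simp⟩
  add_mem' := by
    intro a b ha hb v hv
    obtain ⟨m, hm⟩ := ha v hv
    obtain ⟨n, hn⟩ := hb v hv
    exact ⟨m + n, by simp [hm, hn]⟩
  neg_mem' := by
    intro a ha v hv
    obtain ⟨m, hm⟩ := ha v hv
    exact ⟨-m, by simp [hm]⟩

/-- The dual complex torus `Pic⁰(V ⧸ Λ)`, realized as the conjugate-linear functionals on `V`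
modulo the dual lattice. -/
abbrev DualTorus (Λ : AddSubgroup V) : Type _ := (V →ₗ⋆[ℂ] ℂ) ⧸ dualLattice Λ

/-- The dual endomorphism `φ^∨` (pull-back of line bundles), induced by the transpose
`l ↦ l ∘ F` of the tangent map `F` of `φ`. -/
def Endo.dual [FiniteDimensional ℂ V] {Λ : AddSubgroup V} [Countable Λ] (φ : Endo Λ) :
    DualTorus Λ →+ DualTorus Λ :=
  QuotientAddGroup.map _ _
    ({ toFun := fun l => l.comp φ.tangentMap
       map_zero' := rfl
       map_add' := fun _ _ => rfl } : (V →ₗ⋆[ℂ] ℂ) →+ (V →ₗ⋆[ℂ] ℂ))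
    (fun _ hl _ hv => hl _ (φ.tangentMap_mem hv))

/-- A polarization of `V ⧸ Λ`: a positive definite hermitian form `H` on `V` (linear in the first,
conjugate-linear in the second variable) with `Im H` integral on `Λ`. -/
structure Polarization (Λ : AddSubgroup V) where
  form : V →ₗ[ℂ] V →ₗ⋆[ℂ] ℂ
  hermitian : ∀ v w, conj (form v w) = form w v
  posDef : ∀ v, v ≠ 0 → 0 < (form v v).re
  integral : ∀ v ∈ Λ, ∀ w ∈ Λ, ∃ n : ℤ, (form v w).im = n

/-- The homomorphism `V ⧸ Λ → Pic⁰(V ⧸ Λ)`, `v ↦ H(v, ·)`, of a polarization `H`. -/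
def Polarization.toDual {Λ : AddSubgroup V} (H : Polarization Λ) : V ⧸ Λ →+ DualTorus Λ :=
  QuotientAddGroup.map _ _ H.form.toAddMonoidHom (fun v hv w hw => H.integral v hv w hw)

/-- A polarization is principal if its homomorphism to the dual torus is an isomorphism. -/
def Polarization.IsPrincipal {Λ : AddSubgroup V} (H : Polarization Λ) : Prop :=
  Function.Bijective H.toDual

/-- Linear maps have adjoints with respect to a positive definite hermitian form. -/
theorem Polarization.exists_adjoint [FiniteDimensional ℂ V] {Λ : AddSubgroup V}
    (H : Polarization Λ) (F : V →ₗ[ℂ] V) :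
    ∃ A : V →ₗ[ℂ] V, ∀ v w, H.form (A v) w = H.form v (F w) := by
  have aux : ∀ (W : Type _) [AddCommGroup W] [Module ℂ W] [FiniteDimensional ℂ W]
      (h : W →ₗ[ℂ] W →ₗ⋆[ℂ] ℂ) (_ : ∀ v w, conj (h v w) = h w v)
      (_ : ∀ v, v ≠ 0 → 0 < (h v v).re) (F : W →ₗ[ℂ] W),
      ∃ A : W →ₗ[ℂ] W, ∀ v w, h (A v) w = h v (F w) := by
    intro W _ _ _ h h1 h2 F
    let core : InnerProductSpace.Core ℂ W :=
      { inner := fun v w => h w v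
        conj_inner_symm := fun v w => h1 _ _
        re_inner_nonneg := fun v => by
          by_cases hv : v = 0
          · simp [hv]
          · exact (h2 v hv).le
        add_left := fun x y z => map_add _ _ _
        smul_left := fun x y r => by simp
        definite := fun v hv => by
          by_contra hne
          have := h2 v hne
          rw [hv] at this
          simp at this }
    let : NormedAddCommGroup W := core.toNormedAddCommGroup
    let : InnerProductSpace ℂ W := InnerProductSpace.ofCore core.toCore
    exact ⟨LinearMap.adjoint F, fun v w => LinearMap.adjoint_inner_right F w v⟩
  exact aux V H.form H.hermitian H.posDef F

/-- The Rosati involution of a principal polarization: `φ† = λ⁻¹ ∘ φ^∨ ∘ λ`, where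
`λ : V ⧸ Λ → Pic⁰(V ⧸ Λ)` is the isomorphism given by the polarization. -/
def Polarization.rosati [FiniteDimensional ℂ V] {Λ : AddSubgroup V} [Countable Λ]
    (H : Polarization Λ) (hH : H.IsPrincipal) (φ : Endo Λ) : Endo Λ where
  toHom := ((AddEquiv.ofBijective H.toDual hH).symm.toAddMonoidHom.comp φ.dual).comp H.toDual
  holomorphic := by
    obtain ⟨A, hA⟩ := H.exists_adjoint φ.tangentMap
    intro x
    refine ⟨A, ?_, Filter.Eventually.of_forall fun v => ?_⟩
    · exact (LinearMap.toContinuousLinearMap A).analyticAt x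
    · refine ((AddEquiv.ofBijective H.toDual hH).symm_apply_eq.2 ?_).symm
      change ((H.form v).comp φ.tangentMap : DualTorus Λ) = (H.form (A v) : DualTorus Λ)
      congr 1
      ext w
      exact (hA v w).symm

end Torus

end ComplexTorus

/-! ## Compact Riemann surfaces: differentials, homology, intersection pairing, periods -/

namespace RiemannSurface

section Differentials

/-- The space of holomorphic differentials `H⁰(C, Ω¹)`: families of cotangent vectors which in
every chart are of the form `f(z) dz` with `f` holomorphic. -/
def holomorphicDifferentials (C : Type u) [TopologicalSpace C] [ChartedSpace ℂ C] :
    Submodule ℂ ((x : C) → (TangentSpace 𝓘(ℂ, ℂ) x →L[ℂ] ℂ)) where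
  carrier := {η | ∀ e ∈ atlas ℂ C, DifferentiableOn ℂ
    (fun z : ℂ => η (e.symm z) (mfderiv 𝓘(ℂ, ℂ) 𝓘(ℂ, ℂ) e.symm z (1 : ℂ))) e.target}
  zero_mem' := fun _ _ => differentiableOn_const 0
  add_mem' := fun ha hb e he => (ha e he).add (hb e he)
  smul_mem' := fun c _ ha e he => (ha e he).const_smul c

variable {C : Type u} [TopologicalSpace C] [ChartedSpace ℂ C]

/-- A continuously differentiable path `[0, 1] → C`. -/
structure C1Path (C : Type u) [TopologicalSpace C] [ChartedSpace ℂ C] where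
  toFun : ℝ → C
  contMDiffOn : ContMDiffOn 𝓘(ℝ, ℝ) 𝓘(ℝ, ℂ) 1 toFun (Set.Icc 0 1)

/-- The velocity of a path at time `t`, a tangent vector at `γ(t)`. -/
def C1Path.velocity (γ : C1Path C) (t : ℝ) : TangentSpace 𝓘(ℂ, ℂ) (γ.toFun t) :=
  (mfderivWithin 𝓘(ℝ, ℝ) 𝓘(ℝ, ℂ) γ.toFun (Set.Icc 0 1) t (1 : ℝ) : ℂ)

/-- The integral of a differential along a path. -/
def C1Path.integral (γ : C1Path C) (η : holomorphicDifferentials C) : ℂ :=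
  ∫ t in (0 : ℝ)..1, η.1 (γ.toFun t) (γ.velocity t)

/-- Integral 1-chains of continuously differentiable paths. -/
abbrev C1Chain (C : Type u) [TopologicalSpace C] [ChartedSpace ℂ C] : Type u := C1Path C →₀ ℤ

/-- The integral of a differential over a chain. -/
def chainIntegral (c : C1Chain C) (η : holomorphicDifferentials C) : ℂ :=
  c.sum fun γ n => (n : ℂ) * γ.integral η

/-- A continuously differentiable closed curve, as a `1`-periodic map `ℝ → C`. -/
structure C1Loop (C : Type u) [TopologicalSpace C] [ChartedSpace ℂ C] where
  toFun : ℝ → C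
  contMDiff : ContMDiff 𝓘(ℝ, ℝ) 𝓘(ℝ, ℂ) 1 toFun
  periodic : Function.Periodic toFun 1

/-- A closed curve, seen as a path. -/
def C1Loop.toPath (γ : C1Loop C) : C1Path C := ⟨γ.toFun, γ.contMDiff.contMDiffOn⟩

/-- The velocity of a closed curve at time `t`, in the coordinate of the preferred chart at
`γ(t)`. -/
def C1Loop.velocity (γ : C1Loop C) (t : ℝ) : ℂ :=
  (mfderiv 𝓘(ℝ, ℝ) 𝓘(ℝ, ℂ) γ.toFun t (1 : ℝ) : ℂ)

/-- The parameters in `[0, 1)²` at which two closed curves meet. -/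
def C1Loop.crossings (γ δ : C1Loop C) : Set (ℝ × ℝ) :=
  {p | p.1 ∈ Set.Ico (0 : ℝ) 1 ∧ p.2 ∈ Set.Ico (0 : ℝ) 1 ∧ γ.toFun p.1 = δ.toFun p.2}

/-- The orientation of the pair of velocities at a crossing: it is positive if turning from `γ'`
to `δ'` through an angle less than `π` is counterclockwise, and `0` if they are parallel. -/
def C1Loop.crossingSign (γ δ : C1Loop C) (p : ℝ × ℝ) : ℤ :=
  (SignType.sign ((conj (γ.velocity p.1) * δ.velocity p.2).im) : ℤ)

/-- Two closed curves are transverse if their velocities are linearly independent over `ℝ` at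
every crossing. -/
def C1Loop.Transverse (γ δ : C1Loop C) : Prop :=
  ∀ p ∈ γ.crossings δ, γ.crossingSign δ p ≠ 0

end Differentials

section Homology

/-- The singular chain complex of `C` with integral coefficients. -/
abbrev singularChains (C : Type u) [TopologicalSpace C] : ChainComplex (ModuleCat.{u} ℤ) ℕ :=
  ((AlgebraicTopology.singularChainComplexFunctor (ModuleCat.{u} ℤ)).obj
    (ModuleCat.of ℤ (ULift.{u} ℤ))).obj (TopCat.of C)

/-- The first singular homology group `H₁(C, ℤ)`. -/
abbrev H1 (C : Type u) [TopologicalSpace C] : Type u := (singularChains C).homology 1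

variable {C : Type u} [TopologicalSpace C] [ChartedSpace ℂ C]

/-- The singular 1-simplex of a path: the point with barycentric coordinates `(1 - t, t)` is sent
to `γ(t)`. -/
def C1Path.simplex (γ : C1Path C) :
    (TopCat.toSSet.obj (TopCat.of C)).obj (Opposite.op (SimplexCategory.mk 1)) :=
  (TopCat.toSSetObjEquiv (TopCat.of C) (Opposite.op (SimplexCategory.mk 1))).symm
    ⟨fun p => γ.toFun (p.1 1), γ.contMDiffOn.continuousOn.comp_continuous
      ((continuous_apply 1).comp continuous_subtype_val)
      (fun p => ⟨p.2.1 1, by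
        have h := p.2.2
        have h0 := p.2.1 0
        rw [Fin.sum_univ_two] at h
        linarith⟩)⟩

/-- The singular chain of a path. -/
def C1Path.singularChain (γ : C1Path C) : (singularChains C).X 1 :=
  (Limits.Sigma.ι (fun _ : (TopCat.toSSet.obj (TopCat.of C)).obj
    (Opposite.op (SimplexCategory.mk 1)) => ModuleCat.of ℤ (ULift.{u} ℤ)) γ.simplex).hom
      (ULift.up 1)

/-- The singular chain of a chain of paths. -/
def singularChain (c : C1Chain C) : (singularChains C).X 1 :=
  c.sum fun γ n => n • γ.singularChain

/-- The chain `c` is a cycle with homology class `h`. -/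
def HasClass (c : C1Chain C) (h : H1 C) : Prop :=
  ∃ z : (singularChains C).cycles 1, (singularChains C).iCycles 1 z = singularChain c ∧
    (singularChains C).homologyπ 1 z = h

/-- A bilinear form on `H₁(C, ℤ)` is the intersection pairing if its value on the classes of any
two transverse closed curves is the number of crossings, counted with sign. -/
def IsIntersectionPairing (I : H1 C →ₗ[ℤ] H1 C →ₗ[ℤ] ℤ) : Prop :=
  ∀ (γ δ : C1Loop C) (a b : H1 C), γ.Transverse δ →
    HasClass (Finsupp.single γ.toPath 1) a → HasClass (Finsupp.single δ.toPath 1) b →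
    I a b = ∑ᶠ p ∈ γ.crossings δ, γ.crossingSign δ p

/-- The intersection pairing on `H₁(C, ℤ)`, for a compact connected Riemann surface `C`: the one
bilinear form that counts the crossings of transverse closed curves with sign. -/
def intersectionPairing (C : Type u) [TopologicalSpace C] [ChartedSpace ℂ C] :
    H1 C →ₗ[ℤ] H1 C →ₗ[ℤ] ℤ :=
  Classical.epsilon IsIntersectionPairing

/-- The standard symplectic form `[[0, I], [-I, 0]]`. -/
def stdE (g : ℕ) : Matrix (Fin g ⊕ Fin g) (Fin g ⊕ Fin g) ℤ := Matrix.fromBlocks 0 1 (-1) 0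

/-- A symplectic homology basis `α₁, …, α_g, β₁, …, β_g`: cycles whose classes form a `ℤ`-basis of
`H₁(C, ℤ)` in which the intersection pairing has the standard matrix. -/
structure SymplecticBasis (C : Type u) [TopologicalSpace C] [ChartedSpace ℂ C] (g : ℕ) where
  cycle : Fin g ⊕ Fin g → C1Chain C
  basis : Module.Basis (Fin g ⊕ Fin g) ℤ (H1 C)
  hasClass : ∀ j, HasClass (cycle j) (basis j)
  symplectic : ∀ j k, intersectionPairing C (basis j) (basis k) = stdE g j k

end Homology

section Jacobian

variable {C : Type u} [TopologicalSpace C] [ChartedSpace ℂ C] {g : ℕ}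

/-- The period matrix `Ω = (∫_{α_j} η_i | ∫_{β_j} η_i)`. -/
def periodMatrix (η : Module.Basis (Fin g) ℂ (holomorphicDifferentials C))
    (c : SymplecticBasis C g) : Matrix (Fin g) (Fin g ⊕ Fin g) ℂ :=
  fun i j => chainIntegral (c.cycle j) (η i)

/-- The subgroup `Ω ℤ^{2g}` of `ℂ^g`. -/
def columnLattice (Ω : Matrix (Fin g) (Fin g ⊕ Fin g) ℂ) : AddSubgroup (Fin g → ℂ) :=
  AddMonoidHom.range ({
    toFun := fun n : Fin g ⊕ Fin g → ℤ => Ω *ᵥ (fun j => (n j : ℂ))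
    map_zero' := by
      ext i
      simp [Matrix.mulVec, dotProduct]
    map_add' := fun m n => by
      rw [← Matrix.mulVec_add]
      congr 1
      ext j
      simp } : (Fin g ⊕ Fin g → ℤ) →+ (Fin g → ℂ))

instance columnLattice_countable (Ω : Matrix (Fin g) (Fin g ⊕ Fin g) ℂ) :
    Countable (columnLattice Ω) :=
  (Set.countable_range _).to_subtype

/-- The period lattice `Λ = Ω ℤ^{2g}`.  The Jacobian of `C` is the complex torus `ℂ^g ⧸ Λ`. -/
abbrev periodLattice (η : Module.Basis (Fin g) ℂ (holomorphicDifferentials C))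
    (c : SymplecticBasis C g) : AddSubgroup (Fin g → ℂ) :=
  columnLattice (periodMatrix η c)

/-- The endomorphism `φ` of `ℂ^g ⧸ Ω ℤ^{2g}` has tangent representation `T` and homology
representation `R`: it is induced by `T`, and `T` maps the `j`-th column of `Ω` to the integral
combination of the columns of `Ω` given by the `j`-th column of `R`. -/
def IsRepresentedBy (Ω : Matrix (Fin g) (Fin g ⊕ Fin g) ℂ)
    (φ : ComplexTorus.Endo (columnLattice Ω)) (T : Matrix (Fin g) (Fin g) ℂ)
    (R : Matrix (Fin g ⊕ Fin g) (Fin g ⊕ Fin g) ℤ) : Prop :=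
  (∀ v : Fin g → ℂ, φ.toHom (v : (Fin g → ℂ) ⧸ columnLattice Ω) =
    ((T *ᵥ v : Fin g → ℂ) : (Fin g → ℂ) ⧸ columnLattice Ω)) ∧
  T * Ω = Ω * R.map (Int.cast : ℤ → ℂ)

/-- `H` is the natural polarization of the Jacobian: under the identification of the period
lattice with `H₁(C, ℤ)`, its alternating form `Im H` is the intersection pairing, up to the sign
which the positivity of `H` requires for forms that are linear in the first variable (for
`C = ℂ ⧸ (ℤ + τ ℤ)` with `Im τ > 0` one has `H(v, w) = v * conj w / Im τ`, and `Im H(1, τ) = -1`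
while the cycles `1` and `τ` have intersection number `1`). -/
def IsNaturalPolarization (η : Module.Basis (Fin g) ℂ (holomorphicDifferentials C))
    (c : SymplecticBasis C g) (H : ComplexTorus.Polarization (periodLattice η c)) : Prop :=
  ∀ j k, (H.form ((periodMatrix η c)ᵀ j) ((periodMatrix η c)ᵀ k)).im =
    -(intersectionPairing C (c.basis j) (c.basis k) : ℝ)

end Jacobian

end RiemannSurface

end

open Matrix

noncomputable section

namespace RiemannSurface

open ComplexTorus

/-! ### Matrix identities for the standard symplectic form. -/

section StandardForm

variable (g : ℕ)

/-! The geometry enters only through the identity `Im H(Ω r, Ω s) = -rᵗ E s` for real vectors `r`,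
`s` (`im_form_realComb`). Since `Eᵗ E = 1`, every list of imaginary parts prescribed on the columns
of `Ω` comes from a functional `H(v, ·)`, with `v` given explicitly through `E`. Hence the columns
are a real basis of `ℂ^g`. As `E` is integral, integral imaginary parts correspond exactly to `v` in
the lattice, so `H` is principal.

The Rosati involution is induced by the `H`-adjoint `A` of `T`. Pairing with the columns gives `Im
H(A Ω s, Ω y) = Im H(Ω s, Ω R y) = -sᵗ E R y`. Because `-E Rᵗ E` is the `E`-adjoint of `R`, this
equals `Im H(Ω R† s, Ω y)`, and nondegeneracy yields `A Ω = Ω R†`. Uniqueness holds because the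
tangent map is determined by the endomorphism and the columns are independent over `ℝ`. -/

theorem stdE_mul_stdE : stdE g * stdE g = -1 := by
  rw [stdE, fromBlocks_multiply, ← fromBlocks_one, fromBlocks_neg]
  simp

theorem transpose_stdE : (stdE g)ᵀ = -stdE g := by
  rw [stdE, fromBlocks_transpose, fromBlocks_neg]
  simp

variable {g}

/-- `-E Rᵗ E` is the adjoint of `R` with respect to `E`. -/
theorem adjoint_stdE (R : Matrix (Fin g ⊕ Fin g) (Fin g ⊕ Fin g) ℤ) :
    (-(stdE g * Rᵀ * stdE g))ᵀ * stdE g = stdE g * R := by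
  simp only [transpose_neg, transpose_mul, transpose_transpose, transpose_stdE]
  -- The signs of the two factors `Eᵗ = -E` cancel; the outer sign is absorbed by `E² = -1`.
  simp only [Matrix.mul_neg, Matrix.neg_mul, neg_neg, Matrix.mul_assoc, stdE_mul_stdE,
    Matrix.mul_one]

/-- Needed over `ℝ` for the computation with `Im H`, and over `ℤ` for the final adjointness claim.
-/
theorem adjoint_stdE_dotProduct {S : Type*} [CommRing S]
    (R : Matrix (Fin g ⊕ Fin g) (Fin g ⊕ Fin g) ℤ) (x y : Fin g ⊕ Fin g → S) :
    ((-(stdE g * Rᵀ * stdE g)).map (Int.cast : ℤ → S) *ᵥ x) ⬝ᵥ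
        ((stdE g).map (Int.cast : ℤ → S) *ᵥ y) =
      x ⬝ᵥ ((stdE g).map (Int.cast : ℤ → S) *ᵥ (R.map (Int.cast : ℤ → S) *ᵥ y)) := by
  have h : ((-(stdE g * Rᵀ * stdE g)).map (Int.cast : ℤ → S))ᵀ *
      (stdE g).map (Int.cast : ℤ → S) =
      (stdE g).map (Int.cast : ℤ → S) * R.map (Int.cast : ℤ → S) := by
    change (Matrix.map _ (Int.castRingHom S))ᵀ * Matrix.map _ (Int.castRingHom S) =
      Matrix.map _ (Int.castRingHom S) * Matrix.map _ (Int.castRingHom S)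
    rw [← transpose_map, ← Matrix.map_mul, adjoint_stdE, Matrix.map_mul]
  rw [mulVec_mulVec, ← h, ← mulVec_mulVec, dotProduct_mulVec x, vecMul_transpose]

end StandardForm

/-! ### Real coordinates on `ℂ^g`, principality and the Rosati involution. -/

section Periods

variable {g : ℕ} (Ω : Matrix (Fin g) (Fin g ⊕ Fin g) ℂ)

/-- The real combination of the columns of `Ω` with given coefficients. -/
def realComb : (Fin g ⊕ Fin g → ℝ) →ₗ[ℝ] (Fin g → ℂ) where
  toFun r := Ω *ᵥ fun j => (r j : ℂ)
  map_add' r s := by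
    rw [← mulVec_add]
    congr 1
    ext j
    simp
  map_smul' a r := by
    rw [RingHom.id_apply, ← Complex.coe_smul, ← mulVec_smul]
    congr 1
    ext j
    simp

theorem realComb_apply (r : Fin g ⊕ Fin g → ℝ) :
    realComb Ω r = ∑ j, (r j : ℂ) • Ωᵀ j := by
  ext i
  simp [realComb, mulVec, dotProduct, mul_comm]

theorem realComb_single (j : Fin g ⊕ Fin g) : realComb Ω (Pi.single j 1) = Ωᵀ j := by
  rw [realComb_apply, Finset.sum_eq_single j]
  · simp
  · intro k _ hk
    simp [hk]
  · simp

theorem mem_columnLattice {v : Fin g → ℂ} :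
    v ∈ columnLattice Ω ↔ ∃ n : Fin g ⊕ Fin g → ℤ, realComb Ω (fun j => (n j : ℝ)) = v := by
  simp [columnLattice, realComb]

theorem column_mem_columnLattice (j : Fin g ⊕ Fin g) : Ωᵀ j ∈ columnLattice Ω :=
  (mem_columnLattice Ω).2 ⟨Pi.single j 1, by
    rw [← realComb_single]
    congr 1
    ext k
    by_cases h : k = j
    · subst h; simp
    · simp [h]⟩

variable {Ω} {H : Polarization (columnLattice Ω)}

/-- Conjugation fixes real coefficients, so they leave both slots of `H` unchanged and pass through
`Im`. -/
theorem im_form_realComb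
    (hE : ∀ j k, (H.form (Ωᵀ j) (Ωᵀ k)).im = -(stdE g j k : ℝ))
    (r s : Fin g ⊕ Fin g → ℝ) :
    (H.form (realComb Ω r) (realComb Ω s)).im =
      -(r ⬝ᵥ ((stdE g).map (Int.cast : ℤ → ℝ) *ᵥ s)) := by
  simp only [realComb_apply, map_sum, LinearMap.sum_apply, map_smul, LinearMap.smul_apply,
    LinearMap.map_smulₛₗ, Complex.conj_ofReal, smul_eq_mul, Complex.im_sum, Complex.im_ofReal_mul,
    hE, dotProduct, mulVec, Finset.mul_sum, Matrix.map_apply, ← Finset.sum_neg_distrib]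
  rw [Finset.sum_comm]
  refine Finset.sum_congr rfl fun j _ => Finset.sum_congr rfl fun k _ => ?_
  ring

/-- Every real functional is `Im H(v, ·)` in the coordinates given by the columns of `Ω`. -/
theorem im_form_realComb_stdE
    (hE : ∀ j k, (H.form (Ωᵀ j) (Ωᵀ k)).im = -(stdE g j k : ℝ))
    (t s : Fin g ⊕ Fin g → ℝ) :
    (H.form (realComb Ω ((stdE g).map (Int.cast : ℤ → ℝ) *ᵥ t)) (realComb Ω s)).im =
      -(t ⬝ᵥ s) := by
  have h : ((stdE g).map (Int.cast : ℤ → ℝ))ᵀ * (stdE g).map (Int.cast : ℤ → ℝ) = 1 := by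
    change (Matrix.map _ (Int.castRingHom ℝ))ᵀ * Matrix.map _ (Int.castRingHom ℝ) = 1
    rw [← transpose_map, ← Matrix.map_mul, transpose_stdE, Matrix.neg_mul, stdE_mul_stdE, neg_neg,
      Matrix.map_one _ (map_zero _) (map_one _)]
  rw [im_form_realComb hE, ← vecMul_transpose, ← dotProduct_mulVec, mulVec_mulVec, h, one_mulVec]

/-- If `Ω s = 0`, pairing with `Ω E s` gives `s ⬝ᵥ s = 0`, which forces `s = 0` over `ℝ`. -/
theorem realComb_injective
    (hE : ∀ j k, (H.form (Ωᵀ j) (Ωᵀ k)).im = -(stdE g j k : ℝ)) :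
    Function.Injective (realComb Ω) := by
  refine (injective_iff_map_eq_zero _).2 fun s hs => ?_
  have h := im_form_realComb_stdE hE s s
  rw [hs, map_zero, Complex.zero_im, eq_comm, neg_eq_zero, dotProduct_self_eq_zero] at h
  exact h

/-- Both sides have real dimension `2g`. -/
theorem realComb_surjective
    (hE : ∀ j k, (H.form (Ωᵀ j) (Ωᵀ k)).im = -(stdE g j k : ℝ)) :
    Function.Surjective (realComb Ω) := by
  refine (LinearMap.injective_iff_surjective_of_finrank_eq_finrank ?_).1 (realComb_injective hE)
  rw [Module.finrank_fintype_fun_eq_card, finrank_real_of_complex,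
    Module.finrank_fintype_fun_eq_card, Fintype.card_sum, two_mul]

/-- A conjugate-linear functional is determined by its imaginary parts on the columns of `Ω`. -/
theorem semilinear_ext_im_column
    (hE : ∀ j k, (H.form (Ωᵀ j) (Ωᵀ k)).im = -(stdE g j k : ℝ))
    {l m : (Fin g → ℂ) →ₗ⋆[ℂ] ℂ}
    (h : ∀ j, (l (Ωᵀ j)).im = (m (Ωᵀ j)).im) : l = m := by
  have him : ∀ w, (l w).im = (m w).im := by
    intro w
    obtain ⟨s, rfl⟩ := realComb_surjective hE w
    simp only [realComb_apply, map_sum, LinearMap.map_smulₛₗ, Complex.conj_ofReal, smul_eq_mul,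
      Complex.im_sum, Complex.im_ofReal_mul, h]
  ext1 w
  refine Complex.ext ?_ (him w)
  -- Conjugate-linearity gives `Im l(i w) = -Re l(w)`, so the imaginary parts recover the real
  -- parts.
  have := him (Complex.I • w)
  simpa [LinearMap.map_smulₛₗ] using this

theorem form_injective : Function.Injective H.form := by
  refine (injective_iff_map_eq_zero _).2 fun v hv => ?_
  by_contra hne
  have := H.posDef v hne
  simp [hv] at this

/-- A polarization whose imaginary part has the standard symplectic matrix is principal. -/
theorem isPrincipal_of_symplectic
    (hE : ∀ j k, (H.form (Ωᵀ j) (Ωᵀ k)).im = -(stdE g j k : ℝ)) :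
    H.IsPrincipal := by
  constructor
  · refine (injective_iff_map_eq_zero _).2 fun x hx => ?_
    obtain ⟨v, rfl⟩ := QuotientAddGroup.mk_surjective x
    have hv : H.form v ∈ dualLattice (columnLattice Ω) := (QuotientAddGroup.eq_zero_iff _).1 hx
    choose n hn using fun j => hv _ (column_mem_columnLattice Ω j)
    rw [QuotientAddGroup.eq_zero_iff, mem_columnLattice]
    -- The sign offsets the one in `Im H(Ω E t, Ω s) = -t ⬝ᵥ s`; integrality of `E` and `n` puts the
    -- point in the lattice.
    refine ⟨stdE g *ᵥ (-n), form_injective (H := H) (semilinear_ext_im_column hE fun j => ?_)⟩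
    have e : (fun i => ((stdE g *ᵥ (-n)) i : ℝ)) =
        (stdE g).map (Int.cast : ℤ → ℝ) *ᵥ fun i => -(n i : ℝ) := by
      ext i
      simp [mulVec, dotProduct]
    rw [hn, e, ← realComb_single Ω j, im_form_realComb_stdE hE]
    simp
  · intro y
    obtain ⟨l, rfl⟩ := QuotientAddGroup.mk_surjective y
    -- The same formula with real coefficients represents an arbitrary functional.
    refine ⟨(realComb Ω ((stdE g).map (Int.cast : ℤ → ℝ) *ᵥ fun j => -(l (Ωᵀ j)).im) :
      Fin g → ℂ), congrArg _ (semilinear_ext_im_column hE fun j => ?_)⟩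
    change (H.form _ _).im = _
    rw [← realComb_single Ω j, im_form_realComb_stdE hE]
    simp [realComb_single]

/-- Moves the relation to real vectors, where `Ω` can be cancelled; on `ℂ^{2g}` it has a kernel when
`g > 0`. -/
theorem mul_eq_mul_intCast_iff {T : Matrix (Fin g) (Fin g) ℂ}
    {R : Matrix (Fin g ⊕ Fin g) (Fin g ⊕ Fin g) ℤ} :
    T * Ω = Ω * R.map (Int.cast : ℤ → ℂ) ↔ ∀ s : Fin g ⊕ Fin g → ℝ,
      T *ᵥ realComb Ω s = realComb Ω (R.map (Int.cast : ℤ → ℝ) *ᵥ s) := by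
  have e : ∀ s : Fin g ⊕ Fin g → ℝ, realComb Ω (R.map (Int.cast : ℤ → ℝ) *ᵥ s) =
      (Ω * R.map (Int.cast : ℤ → ℂ)) *ᵥ fun j => (s j : ℂ) := by
    intro s
    rw [← mulVec_mulVec]
    change Ω *ᵥ _ = _
    congr 1
    ext i
    simp [mulVec, dotProduct]
  have e' : ∀ s : Fin g ⊕ Fin g → ℝ, T *ᵥ realComb Ω s = (T * Ω) *ᵥ fun j => (s j : ℂ) :=
    fun s => mulVec_mulVec _ _ _
  refine ⟨fun h s => by rw [e, e', h], fun h => Matrix.ext_of_mulVec_single fun j => ?_⟩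
  have hj := h (Pi.single j 1)
  rw [e, e'] at hj
  have es : (fun k => ((Pi.single j 1 : Fin g ⊕ Fin g → ℝ) k : ℂ)) = Pi.single j 1 := by
    ext k
    by_cases hk : k = j
    · subst hk; simp
    · simp [hk]
  rwa [es] at hj

/-- The Rosati involution is induced by the adjoint of the tangent map. -/
theorem rosati_toHom_mk (hP : H.IsPrincipal) (φ : Endo (columnLattice Ω))
    {A : (Fin g → ℂ) →ₗ[ℂ] (Fin g → ℂ)}
    (hA : ∀ v w, H.form (A v) w = H.form v (φ.tangentMap w)) (v : Fin g → ℂ) :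
    (H.rosati hP φ).toHom (v : (Fin g → ℂ) ⧸ columnLattice Ω) =
      ((A v : Fin g → ℂ) : (Fin g → ℂ) ⧸ columnLattice Ω) := by
  refine (AddEquiv.ofBijective H.toDual hP).symm_apply_eq.2 ?_
  change ((H.form v).comp φ.tangentMap : DualTorus (columnLattice Ω)) =
    (H.form (A v) : DualTorus (columnLattice Ω))
  congr 1
  ext w
  exact (hA v w).symm

theorem IsRepresentedBy.tangentMap_eq {φ : Endo (columnLattice Ω)} {T : Matrix (Fin g) (Fin g) ℂ}
    {R : Matrix (Fin g ⊕ Fin g) (Fin g ⊕ Fin g) ℤ} (h : IsRepresentedBy Ω φ T R) :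
    φ.tangentMap = toLin' T :=
  lift_unique (Λ := columnLattice Ω) fun v => by
    rw [φ.mk_tangentMap, h.1, toLin'_apply]

/-- The homology representation of an endomorphism is unique. -/
theorem IsRepresentedBy.homology_unique
    (hE : ∀ j k, (H.form (Ωᵀ j) (Ωᵀ k)).im = -(stdE g j k : ℝ))
    {φ : Endo (columnLattice Ω)}
    {T T' : Matrix (Fin g) (Fin g) ℂ} {R R' : Matrix (Fin g ⊕ Fin g) (Fin g ⊕ Fin g) ℤ}
    (h : IsRepresentedBy Ω φ T R) (h' : IsRepresentedBy Ω φ T' R') : R = R' := by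
  have hT : T = T' := toLin'.injective (h.tangentMap_eq.symm.trans h'.tangentMap_eq)
  refine Matrix.map_injective (Int.cast_injective (α := ℝ)) (Matrix.ext_of_mulVec_single fun j => ?_)
  refine realComb_injective hE ?_
  rw [← mul_eq_mul_intCast_iff.1 h.2, ← mul_eq_mul_intCast_iff.1 h'.2, hT]

/-- The homology representation of the Rosati involution. -/
theorem IsRepresentedBy.rosati
    (hE : ∀ j k, (H.form (Ωᵀ j) (Ωᵀ k)).im = -(stdE g j k : ℝ))
    {φ : Endo (columnLattice Ω)}
    {T : Matrix (Fin g) (Fin g) ℂ} {R : Matrix (Fin g ⊕ Fin g) (Fin g ⊕ Fin g) ℤ}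
    (h : IsRepresentedBy Ω φ T R) (hP : H.IsPrincipal) :
    ∃ T' : Matrix (Fin g) (Fin g) ℂ,
      IsRepresentedBy Ω (H.rosati hP φ) T' (-(stdE g * Rᵀ * stdE g)) := by
  obtain ⟨A, hA⟩ := H.exists_adjoint φ.tangentMap
  refine ⟨LinearMap.toMatrix' A, fun v => ?_, mul_eq_mul_intCast_iff.2 fun s => ?_⟩
  · rw [rosati_toHom_mk hP φ hA, LinearMap.toMatrix'_mulVec]
  · rw [LinearMap.toMatrix'_mulVec]
    -- Equality of two vectors is tested by `Im H(·, Ω_j)` on all columns.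
    refine form_injective (H := H) (semilinear_ext_im_column hE fun j => ?_)
    rw [hA, h.tangentMap_eq, toLin'_apply, ← realComb_single Ω j, mul_eq_mul_intCast_iff.1 h.2,
      im_form_realComb hE, im_form_realComb hE, adjoint_stdE_dotProduct]

end Periods

end RiemannSurface

end

theorem mainTheorem2 {C : Type u} [TopologicalSpace C] [T2Space C] [CompactSpace C]
    [ConnectedSpace C] [ChartedSpace ℂ C] [IsManifold 𝓘(ℂ, ℂ) 1 C] (g : ℕ)
    (η : Module.Basis (Fin g) ℂ (RiemannSurface.holomorphicDifferentials C))
    (c : RiemannSurface.SymplecticBasis C g)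
    (H : ComplexTorus.Polarization (RiemannSurface.periodLattice η c))
    (hH : RiemannSurface.IsNaturalPolarization η c H) :
    ∃ hP : H.IsPrincipal,
      ∀ (φ : ComplexTorus.Endo (RiemannSurface.periodLattice η c))
        (T : Matrix (Fin g) (Fin g) ℂ) (R R' : Matrix (Fin g ⊕ Fin g) (Fin g ⊕ Fin g) ℤ),
        RiemannSurface.IsRepresentedBy (RiemannSurface.periodMatrix η c) φ T R →
        R' = -(RiemannSurface.stdE g * Rᵀ * RiemannSurface.stdE g) →
        (∃ T' : Matrix (Fin g) (Fin g) ℂ, RiemannSurface.IsRepresentedBy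
          (RiemannSurface.periodMatrix η c) (H.rosati hP φ) T' R') ∧
        (∀ (T'' : Matrix (Fin g) (Fin g) ℂ) (R'' : Matrix (Fin g ⊕ Fin g) (Fin g ⊕ Fin g) ℤ),
          RiemannSurface.IsRepresentedBy
            (RiemannSurface.periodMatrix η c) (H.rosati hP φ) T'' R'' → R'' = R') ∧
        (∀ x y : Fin g ⊕ Fin g → ℤ,
          (R' *ᵥ x) ⬝ᵥ (RiemannSurface.stdE g *ᵥ y) =
            x ⬝ᵥ (RiemannSurface.stdE g *ᵥ (R *ᵥ y))) := by
  have hE : ∀ j k, (H.form ((RiemannSurface.periodMatrix η c)ᵀ j)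
      ((RiemannSurface.periodMatrix η c)ᵀ k)).im = -(RiemannSurface.stdE g j k : ℝ) :=
    fun j k => by rw [hH j k, c.symplectic]
  refine ⟨RiemannSurface.isPrincipal_of_symplectic hE, fun φ T R R' h hR => ?_⟩
  subst hR
  obtain ⟨T', hT'⟩ := h.rosati hE (RiemannSurface.isPrincipal_of_symplectic hE)
  refine ⟨⟨T', hT'⟩, fun T'' R'' h'' => h''.homology_unique hE hT', fun x y => ?_⟩
  -- Removes the trivial casts left by taking `S = ℤ`.
  have e : ∀ M : Matrix (Fin g ⊕ Fin g) (Fin g ⊕ Fin g) ℤ, M.map (Int.cast : ℤ → ℤ) = M :=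
    fun M => by ext; simp
  simpa only [e] using RiemannSurface.adjoint_stdE_dotProduct R x y
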